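/- Let $p$ be a prime and let $v_p$ denote the $p$-adic valuation on $\mathbb{Z}$, with $v_p(0)=\infty$. Let $f,g\in\mathbb{Z}[x]$ be monic polynomials with resultant $r$, and let $s_1,s_2$ be non-negative integers such that $v_p(f(n))\ge s_1$ and $v_p(g(n))\ge s_2$ for every integer $n$. Suppose that the maximum $$S=\max_{n\in\mathbb{Z}}\min\{v_p(f(n)),v_p(g(n))\}$$ exists and is finite. Then $$v_p(r)\ \ge\ S-\max\{s_1,s_2\}+p\,s_1s_2\,\frac{p-1}{p-p^{-k}},\qquad k=\lfloor\log_p((p-1)\max\{s_1,s_2\}+1)\rfloor-1 .$$ (If $s_1=s_2=0$, so that $k=-1$ and the denominator vanishes, the last term is read as $0$. If $r=0$, then $v_p(r)=\infty$ and the inequality holds trivially.) -/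

import Mathlib

open Polynomial
open scoped ENNReal

/-! Over the algebraic closure of `ℚ_[p]`, the valuation of the resultant is the sum of the
valuations of `α i - β k` over all pairs of roots. The hypotheses say that every integer has total
proximity at least `s₁` to the `α i` and `s₂` to the `β k`, and that at some integer `c` both totals
reach `S`. From here on only the axioms of `IsPadicProximity` matter.

The bound is proved by induction through residue classes (`hasPairBound`). In a subclass modulo `p ^
(j + 1)` of a ball of level `j`, let `U`, `V` be the totals of the two families between levels `j`
and `j + 1`. The pairs earn at least `U * V` and `min U V` in this layer, and the smaller ball still
faces the demands `s₁ - U`, `s₂ - V`. Averaging forces `U ≥ a * s₁` and `V ≥ a * s₂` with `a = p ^ m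
/ (1 + ⋯ + p ^ m)` (`le_sum_layer`), and then each subclass yields `a * s₁ * s₂` (`class_bound`). No
pair counts for two subclasses (`sum_class_le`), so the `p` yields add up. The excess `E`, finally
`S - max s₁ s₂` or `0`, is carried along the subclasses of `c` alone. -/

/-- A symmetric ultrametric proximity `d` on `X` whose restriction to the integers, embedded by `ι`,
agrees with the `p`-adic valuation of the difference up to the height `T`. -/
structure IsPadicProximity (p T : ℕ) {X : Type*} (d : X → X → ℝ) (ι : ℤ → X) : Prop where
  symm : ∀ x y, d x y = d y x
  ultra : ∀ x y z, min (d x y) (d y z) ≤ d x z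
  le_of_dvd : ∀ (i : ℕ) (a b : ℤ), i ≤ T → (p : ℤ) ^ i ∣ a - b → (i : ℝ) ≤ d (ι a) (ι b)
  le_of_not_dvd : ∀ (i : ℕ) (a b : ℤ), ¬ (p : ℤ) ^ (i + 1) ∣ a - b → d (ι a) (ι b) ≤ i

/-! ### Geometric sums and inequalities for finite sums. -/

/-- The sum `1 + p + ⋯ + p ^ (m - 1)`. -/
def geomSum (p m : ℕ) : ℝ := ∑ i ∈ Finset.range m, (p : ℝ) ^ i

lemma geomSum_zero (p : ℕ) : geomSum p 0 = 0 := by simp [geomSum]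

lemma geomSum_succ (p m : ℕ) : geomSum p (m + 1) = geomSum p m + (p : ℝ) ^ m := by
  simp [geomSum, Finset.sum_range_succ]

lemma geomSum_succ' (p m : ℕ) : geomSum p (m + 1) = p * geomSum p m + 1 := by
  simp [geomSum, Finset.sum_range_succ', Finset.mul_sum, pow_succ']

lemma geomSum_nonneg (p m : ℕ) : 0 ≤ geomSum p m :=
  Finset.sum_nonneg fun _ _ => by positivity

lemma geomSum_succ_pos (p m : ℕ) : 0 < geomSum p (m + 1) := by
  rw [geomSum_succ']
  have := geomSum_nonneg p m
  positivity

/-- Used for sums over residue classes: a point lies in at most one class, so at most one term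
survives. -/
lemma sum_le_of_pairwise_eq_zero {s : Finset ℕ} {g : ℕ → ℝ} {M : ℝ} (hM : 0 ≤ M)
    (hg : ∀ r ∈ s, g r ≤ M) (h : ∀ r ∈ s, ∀ r' ∈ s, r ≠ r' → g r = 0 ∨ g r' = 0) :
    ∑ r ∈ s, g r ≤ M := by
  by_cases hr : ∃ r ∈ s, g r ≠ 0
  · obtain ⟨r, hrs, hr⟩ := hr
    rw [Finset.sum_eq_single_of_mem r hrs fun r' hr' hne => (h r hrs r' hr' hne.symm).resolve_left hr]
    exact hg r hrs
  · push Not at hr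
    rw [Finset.sum_eq_zero hr]
    exact hM

/-- If two finite families of nonnegative reals have sums `U` and `V`, the sum of the pairwise minima
is at least `min U V`. -/
lemma min_sum_le_sum_min {I J : Type*} (A : Finset I) (B : Finset J) (u : I → ℝ) (v : J → ℝ)
    (hu : ∀ i ∈ A, 0 ≤ u i) (hv : ∀ k ∈ B, 0 ≤ v k) :
    min (∑ i ∈ A, u i) (∑ k ∈ B, v k) ≤ ∑ i ∈ A, ∑ k ∈ B, min (u i) (v k) := by
  set U := ∑ i ∈ A, u i with hU
  set V := ∑ k ∈ B, v k with hV
  have hU0 : 0 ≤ U := Finset.sum_nonneg hu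
  have hV0 : 0 ≤ V := Finset.sum_nonneg hv
  have hprod : U * V = ∑ i ∈ A, ∑ k ∈ B, u i * v k := Finset.sum_mul_sum A B u v
  -- Termwise, `u i * v k` is the minimum times the maximum, and the maximum is at most `max U V`,
  -- which is divided out at the end.
  have hmain : U * V ≤ max U V * ∑ i ∈ A, ∑ k ∈ B, min (u i) (v k) := by
    rw [hprod, Finset.mul_sum]
    refine Finset.sum_le_sum fun i hi => ?_
    rw [Finset.mul_sum]
    refine Finset.sum_le_sum fun k hk => ?_
    rw [← min_mul_max (u i) (v k), mul_comm]
    refine mul_le_mul_of_nonneg_right (max_le_max ?_ ?_) (le_min (hu i hi) (hv k hk))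
    · exact Finset.single_le_sum hu hi
    · exact Finset.single_le_sum hv hk
  rcases (le_max_of_le_left hU0 : 0 ≤ max U V).eq_or_lt with h0 | hpos
  · have : min U V ≤ 0 := (min_le_max).trans h0.symm.le
    exact this.trans (Finset.sum_nonneg fun i hi => Finset.sum_nonneg fun k hk =>
      le_min (hu i hi) (hv k hk))
  · rw [← min_mul_max U V, mul_comm] at hmain
    exact le_of_mul_le_mul_left hmain hpos

/-- If moreover the reals are at most `1`, it is at least `U * V`. -/
lemma sum_mul_sum_le_sum_min {I J : Type*} (A : Finset I) (B : Finset J) (u : I → ℝ) (v : J → ℝ)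
    (hu : ∀ i ∈ A, 0 ≤ u i) (hv : ∀ k ∈ B, 0 ≤ v k) (hu1 : ∀ i ∈ A, u i ≤ 1)
    (hv1 : ∀ k ∈ B, v k ≤ 1) :
    (∑ i ∈ A, u i) * (∑ k ∈ B, v k) ≤ ∑ i ∈ A, ∑ k ∈ B, min (u i) (v k) := by
  rw [Finset.sum_mul_sum]
  refine Finset.sum_le_sum fun i hi => Finset.sum_le_sum fun k hk => le_min ?_ ?_
  · exact mul_le_of_le_one_right (hu i hi) (hv1 k hk)
  · exact mul_le_of_le_one_left (hv k hk) (hu1 i hi)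

/-! ### Layers of a ball and averaging over residue classes. -/

namespace IsPadicProximity

variable {p T : ℕ} {X : Type*} {d : X → X → ℝ} {ι : ℤ → X}

/-- The part of the proximity of `x` and `c` that lies between the levels `j` and `j + 1`. -/
def layer (d : X → X → ℝ) (ι : ℤ → X) (j : ℕ) (c : ℤ) (x : X) : ℝ := min (d x (ι c)) (j + 1) - j

lemma layer_le_one (j : ℕ) (c : ℤ) (x : X) : layer d ι j c x ≤ 1 := by
  have := min_le_right (d x (ι c)) (j + 1 : ℝ)
  unfold layer; linarith

lemma layer_nonneg {j : ℕ} {c : ℤ} {x : X} (h : (j : ℝ) ≤ d x (ι c)) : 0 ≤ layer d ι j c x :=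
  sub_nonneg.2 (le_min h (by linarith))

lemma layer_eq_one {j : ℕ} {c : ℤ} {x : X} (h : ((j + 1 : ℕ) : ℝ) ≤ d x (ι c)) :
    layer d ι j c x = 1 := by
  push_cast at h
  rw [layer, min_eq_right h]; ring

lemma ball_shift (h : IsPadicProximity p T d ι) {j : ℕ} (hj : j ≤ T) {c c' : ℤ}
    (hc : (p : ℤ) ^ j ∣ c' - c) {x : X} (hx : (j : ℝ) ≤ d x (ι c)) : (j : ℝ) ≤ d x (ι c') := by
  refine (le_min hx ?_).trans (h.ultra x (ι c) (ι c'))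
  exact h.le_of_dvd j _ _ hj ((dvd_sub_comm).1 hc)

lemma eq_of_lt (h : IsPadicProximity p T d ι) {x y z : X} (hlt : d x y < d y z) :
    d x z = d x y := by
  apply le_antisymm
  · by_contra! hc
    have := h.ultra x z y
    rw [h.symm z y] at this
    exact absurd (lt_min hc hlt) (not_lt.2 this)
  · simpa [min_eq_left hlt.le] using h.ultra x y z

/-- Two distinct residue classes modulo `p` inside a ball have no common member. -/
lemma not_both_lt (h : IsPadicProximity p T d ι) (hp : 0 < p) (j : ℕ) (c : ℤ) {r r' : ℕ}
    (hr : r < p) (hr' : r' < p) (hne : r ≠ r') (x : X)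
    (h1 : (j : ℝ) < d x (ι (c + r * p ^ j))) : d x (ι (c + r' * p ^ j)) ≤ j := by
  by_contra! h2
  have h3 := h.ultra (ι (c + r * p ^ j)) x (ι (c + r' * p ^ j))
  rw [h.symm _ x] at h3
  have h4 : d (ι (c + r * p ^ j)) (ι (c + r' * p ^ j)) ≤ j := by
    apply h.le_of_not_dvd
    intro hd
    rw [show (c + r * p ^ j : ℤ) - (c + r' * p ^ j) = p ^ j * (r - r') by ring, pow_succ] at hd
    have hd' : (p : ℤ) ∣ r - r' := Int.dvd_of_mul_dvd_mul_left (by positivity) hd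
    obtain ⟨t, ht⟩ := hd'
    have : t = 0 := by
      by_contra ht0
      have h1 : (p : ℤ) ≤ |(p : ℤ) * t| := by
        rw [abs_mul]
        have : 1 ≤ |t| := Int.one_le_abs ht0
        have hp' : |(p : ℤ)| = p := abs_of_nonneg (by positivity)
        rw [hp']; nlinarith
      rw [← ht] at h1
      have : |(r : ℤ) - r'| < p := abs_lt.2 ⟨by omega, by omega⟩
      omega
    subst this
    omega
  linarith [lt_min h1 h2]

/-- A point that does not reach level `j + 1` near `c` is equally close to `n` and to `c` (isosceles
triangles), so it contributes its layer only; a point that does fills the whole layer. -/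
lemma sum_eq_layer_add (h : IsPadicProximity p T d ι) {I : Type*} (α : I → X) (A : Finset I)
    {j : ℕ} (hj : j + 1 ≤ T) {c n : ℤ} (hn : (p : ℤ) ^ (j + 1) ∣ n - c) :
    ∑ i ∈ A, (d (α i) (ι n) - j) = ∑ i ∈ A, layer d ι j c (α i)
      + ∑ i ∈ A with ((j + 1 : ℕ) : ℝ) ≤ d (α i) (ι c), (d (α i) (ι n) - (j + 1 : ℕ)) := by
  rw [Finset.sum_filter, ← Finset.sum_add_distrib]
  refine Finset.sum_congr rfl fun i _ => ?_
  have hcn := h.le_of_dvd (j + 1) c n hj ((dvd_sub_comm).1 hn)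
  split_ifs with hi
  · rw [layer_eq_one hi]; push_cast; ring
  · push Not at hi
    rw [h.eq_of_lt (hi.trans_le hcn), layer, min_eq_left (by push_cast at hi; exact hi.le), add_zero]

/-- A least populated residue class. -/
lemma exists_class (h : IsPadicProximity p T d ι) (hp : 0 < p) {I : Type*} (α : I → X)
    (A : Finset I) (j : ℕ) (c : ℤ) :
    ∃ r : ℕ, p * ({i ∈ A | (j : ℝ) < d (α i) (ι (c + r * p ^ j))} : Finset I).card ≤ A.card := by
  by_contra! hc
  have h1 : (∑ r ∈ Finset.range p,
      (({i ∈ A | (j : ℝ) < d (α i) (ι (c + r * p ^ j))} : Finset I).card : ℝ)) ≤ A.card := by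
    simp_rw [Finset.card_filter, Nat.cast_sum]
    rw [Finset.sum_comm, Finset.card_eq_sum_ones, Nat.cast_sum]
    refine Finset.sum_le_sum fun i _ => sum_le_of_pairwise_eq_zero (by simp) ?_ ?_
    · intro r _; split_ifs <;> simp
    · intro r hr r' hr' hne
      by_cases hr1 : (j : ℝ) < d (α i) (ι (c + r * p ^ j))
      · right
        rw [if_neg (not_lt.2 (h.not_both_lt hp j c (Finset.mem_range.1 hr)
          (Finset.mem_range.1 hr') hne _ hr1))]; simp
      · left; simp [hr1]
  have h2 : (p : ℝ) * A.card < p * (∑ r ∈ Finset.range p,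
      (({i ∈ A | (j : ℝ) < d (α i) (ι (c + r * p ^ j))} : Finset I).card : ℝ)) := by
    rw [Finset.mul_sum]
    calc (p : ℝ) * A.card = ∑ r ∈ Finset.range p, (A.card : ℝ) := by simp
      _ < _ := Finset.sum_lt_sum_of_nonempty (Finset.nonempty_range_iff.2 hp.ne')
        fun r _ => by exact_mod_cast hc r
  have : (0 : ℝ) < p := by exact_mod_cast hp
  nlinarith

/-- Fewer than `p ^ (m + 1)` points of a ball have, on average, a proximity of at most
`geomSum p m / p ^ m` to some integer of the ball. -/
lemma exists_sum_le (h : IsPadicProximity p T d ι) (hp : 0 < p) {I : Type*} (α : I → X) (m : ℕ) :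
    ∀ (j : ℕ) (c : ℤ) (A : Finset I), j + m + 1 ≤ T → (∀ i ∈ A, (j : ℝ) ≤ d (α i) (ι c)) →
      A.card < p ^ (m + 1) → ∃ n : ℤ, (p : ℤ) ^ j ∣ n - c ∧
        (p : ℝ) ^ m * ∑ i ∈ A, (d (α i) (ι n) - j) ≤ A.card * geomSum p m := by
  induction m with
  | zero =>
    intro j c A _ hA hcard
    obtain ⟨r, hr⟩ := h.exists_class hp α A j c
    refine ⟨c + r * p ^ j, ⟨r, by ring⟩, ?_⟩
    -- Fewer than `p` points: a class holding at most a `1 / p` share is empty.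
    have h0 : ({i ∈ A | (j : ℝ) < d (α i) (ι (c + r * p ^ j))} : Finset I).card = 0 := by
      by_contra h0
      have : p * 1 ≤ p * ({i ∈ A | (j : ℝ) < d (α i) (ι (c + r * p ^ j))} : Finset I).card :=
        Nat.mul_le_mul_left _ (Nat.one_le_iff_ne_zero.2 h0)
      simp at hcard
      omega
    rw [Finset.card_eq_zero, Finset.filter_eq_empty_iff] at h0
    rw [geomSum_zero, mul_zero, pow_zero, one_mul]
    exact Finset.sum_nonpos fun i hi => by have := h0 hi; push Not at this; linarith
  | succ m ih =>
    intro j c A hT hA hcard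
    obtain ⟨r, hr⟩ := h.exists_class hp α A j c
    set c' : ℤ := c + r * p ^ j with hc'
    set C := ({i ∈ A | (j : ℝ) < d (α i) (ι c')} : Finset I) with hC
    set A' := ({i ∈ A | ((j + 1 : ℕ) : ℝ) ≤ d (α i) (ι c')} : Finset I) with hA'
    have hsub : A'.card ≤ C.card := by
      refine Finset.card_le_card fun i hi => ?_
      rw [hA', Finset.mem_filter] at hi
      rw [hC, Finset.mem_filter]
      refine ⟨hi.1, lt_of_lt_of_le ?_ hi.2⟩
      push_cast; linarith
    have hcard' : A'.card < p ^ (m + 1) := by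
      have : p * A'.card < p * p ^ (m + 1) :=
        (Nat.mul_le_mul_left p hsub).trans_lt (hr.trans_lt (by rwa [← pow_succ']))
      exact Nat.lt_of_mul_lt_mul_left this
    obtain ⟨n, hn, hsum⟩ := ih (j + 1) c' A' (by omega)
      (fun i hi => (Finset.mem_filter.1 hi).2) hcard'
    refine ⟨n, ?_, ?_⟩
    · have h1 : (p : ℤ) ^ j ∣ n - c' := (pow_dvd_pow _ (Nat.le_succ j)).trans hn
      have h2 : (p : ℤ) ^ j ∣ c' - c := ⟨r, by rw [hc']; ring⟩
      simpa using dvd_add h1 h2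
    · rw [h.sum_eq_layer_add α A (by omega) hn]
      have hlayer : ∑ i ∈ A, layer d ι j c' (α i) ≤ C.card := by
        rw [hC, Finset.card_filter, Nat.cast_sum]
        refine Finset.sum_le_sum fun i _ => ?_
        split_ifs with hi
        · simpa using layer_le_one j c' (α i)
        · push Not at hi
          have := min_le_left (d (α i) (ι c')) (j + 1 : ℝ)
          simp only [layer, Nat.cast_zero]; linarith
      have hg := geomSum_nonneg p m
      have h1 : (A'.card : ℝ) ≤ C.card := by exact_mod_cast hsub
      have h2 : (p : ℝ) * C.card ≤ A.card := by exact_mod_cast hr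
      have hP : (0 : ℝ) < (p : ℝ) ^ m := by positivity
      have h3 : (p : ℝ) ^ m * (∑ i ∈ A, layer d ι j c' (α i)
          + ∑ i ∈ A', (d (α i) (ι n) - (j + 1 : ℕ))) ≤ C.card * geomSum p (m + 1) := by
        rw [geomSum_succ, mul_add]
        have := mul_le_mul_of_nonneg_left hlayer hP.le
        have := mul_le_mul_of_nonneg_right h1 hg
        linarith
      calc _ = (p : ℝ) * ((p : ℝ) ^ m * (∑ i ∈ A, layer d ι j c' (α i)
          + ∑ i ∈ A', (d (α i) (ι n) - (j + 1 : ℕ)))) := by rw [pow_succ]; ring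
        _ ≤ p * (C.card * geomSum p (m + 1)) := mul_le_mul_of_nonneg_left h3 (by positivity)
        _ = (p * C.card) * geomSum p (m + 1) := by ring
        _ ≤ _ := mul_le_mul_of_nonneg_right h2 (geomSum_nonneg _ _)

/-- If every integer of a class has total proximity at least `s`, a fixed proportion of `s` comes
from the first layer. -/
lemma le_sum_layer (h : IsPadicProximity p T d ι) (hp : 0 < p) {I : Type*} (α : I → X)
    (A : Finset I) {m j : ℕ} (hT : j + m + 2 ≤ T) {c : ℤ} (hA : ∀ i ∈ A, (j : ℝ) ≤ d (α i) (ι c))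
    {s : ℝ} (hs : s ≤ p * geomSum p (m + 1))
    (hn : ∀ n : ℤ, (p : ℤ) ^ (j + 1) ∣ n - c → s ≤ ∑ i ∈ A, (d (α i) (ι n) - j)) :
    (p : ℝ) ^ m * s ≤ geomSum p (m + 1) * ∑ i ∈ A, layer d ι j c (α i) := by
  set U := ∑ i ∈ A, layer d ι j c (α i) with hU
  set A' := ({i ∈ A | ((j + 1 : ℕ) : ℝ) ≤ d (α i) (ι c)} : Finset I) with hA'
  have hcard : (A'.card : ℝ) ≤ U := by
    rw [hA', Finset.card_filter, Nat.cast_sum]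
    refine Finset.sum_le_sum fun i hi => ?_
    split_ifs with hi'
    · rw [layer_eq_one hi']; simp
    · simpa using layer_nonneg (hA i hi)
  have hgp := geomSum_succ_pos p m
  have hpp : (0 : ℝ) < (p : ℝ) ^ m := by positivity
  -- With few deep points, some integer of the class has deep total at most `U * geomSum p m / p ^
  -- m`, so the layer must supply the rest of `s`. With many, `U ≥ p ^ (m + 1)` and the cap on `s`
  -- suffices.
  rcases lt_or_ge A'.card (p ^ (m + 1)) with hlt | hge
  · obtain ⟨n, hnc, hsum⟩ := h.exists_sum_le hp α m (j + 1) c A' (by omega)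
      (fun i hi => (Finset.mem_filter.1 hi).2) hlt
    have h1 := hn n hnc
    rw [h.sum_eq_layer_add α A (by omega) hnc] at h1
    have h2 := mul_le_mul_of_nonneg_left h1 hpp.le
    have h3 := mul_le_mul_of_nonneg_right hcard (geomSum_nonneg p m)
    rw [geomSum_succ]
    linarith
  · have h1 : (p : ℝ) ^ (m + 1) ≤ A'.card := by exact_mod_cast hge
    calc (p : ℝ) ^ m * s ≤ p ^ m * (p * geomSum p (m + 1)) := mul_le_mul_of_nonneg_left hs hpp.le
      _ = geomSum p (m + 1) * p ^ (m + 1) := by ring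
      _ ≤ _ := mul_le_mul_of_nonneg_left (h1.trans hcard) hgp.le

end IsPadicProximity

/-! ### The inequality for one residue class. -/

/-- The numerical inequality behind the induction step, for one residue class. -/
lemma class_bound {s₁ s₂ E U V W P a c : ℝ} (hs₁ : 0 ≤ s₁) (hs₂ : 0 ≤ s₂) (hE : 0 ≤ E)
    (ha : 0 ≤ a) (ha1 : a ≤ 1) (hc : a < 1 → c * (1 - a) = a) (hc0 : 0 ≤ c)
    (hU : a * s₁ ≤ U) (hV : a * s₂ ≤ V) (hW : U * V ≤ W) (hW' : min U V ≤ W) (hP : 0 ≤ P)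
    (hU1 : U < 1 → s₁ + E ≤ U) (hV1 : V < 1 → s₂ + E ≤ V)
    (h1 : U ≤ s₁ → V ≤ s₂ → E + c * ((s₁ - U) * (s₂ - V)) ≤ P)
    (h2 : 0 < max (U - s₁) (V - s₂) → E - max (U - s₁) (V - s₂) ≤ P) :
    E + a * (s₁ * s₂) ≤ W + P := by
  have hss : a * (s₁ * s₂) ≤ s₁ * s₂ := mul_le_of_le_one_left (mul_nonneg hs₁ hs₂) ha1
  have hU0 : 0 ≤ U := (mul_nonneg ha hs₁).trans hU
  have hV0 : 0 ≤ V := (mul_nonneg ha hs₂).trans hV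
  by_cases hle : U ≤ s₁ ∧ V ≤ s₂
  · have h1 := h1 hle.1 hle.2
    suffices a * (s₁ * s₂) ≤ U * V + c * ((s₁ - U) * (s₂ - V)) by linarith
    rcases ha1.lt_or_eq with hlt | rfl
    · have hpos : 0 < 1 - a := by linarith
      refine le_of_mul_le_mul_left ?_ hpos
      have e : (1 - a) * (U * V + c * ((s₁ - U) * (s₂ - V)))
          = (1 - a) * (U * V) + c * (1 - a) * ((s₁ - U) * (s₂ - V)) := by ring
      rw [e, hc hlt]
      -- The two sides differ by exactly `(U - a * s₁) * (V - a * s₂)`.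
      nlinarith [mul_nonneg (sub_nonneg.2 hU) (sub_nonneg.2 hV)]
    · have : 0 ≤ c * ((s₁ - U) * (s₂ - V)) :=
        mul_nonneg hc0 (mul_nonneg (sub_nonneg.2 hle.1) (sub_nonneg.2 hle.2))
      have : s₁ * s₂ ≤ U * V := mul_le_mul (by linarith) (by linarith) hs₂ hU0
      linarith
  · have hpos : 0 < max (U - s₁) (V - s₂) := by
      rw [not_and_or] at hle
      rcases hle with h | h
      · exact lt_max_of_lt_left (by linarith)
      · exact lt_max_of_lt_right (by linarith)
    have h2 := h2 hpos
    -- the case in which one of the first layers is thin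
    have thin : ∀ {s t X Y : ℝ}, 0 ≤ s → 0 ≤ t → a * s ≤ X → X * Y ≤ W → min X Y ≤ W →
        (X < 1 → s + E ≤ X) → t + E ≤ Y → Y < 1 → a * (s * t) + E ≤ W := by
      intro s t X Y hs ht hX hXY hmin hX1 hY hY1
      have ht1 : t ≤ 1 := by linarith
      have hst : a * (s * t) ≤ s * t := mul_le_of_le_one_left (mul_nonneg hs ht) ha1
      rcases lt_or_ge X 1 with hX' | hX'
      · have := hX1 hX'
        have hs1 : s ≤ 1 := by linarith
        refine le_trans (le_min ?_ ?_) hmin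
        · linarith [mul_le_of_le_one_right hs ht1]
        · linarith [mul_le_of_le_one_left ht hs1]
      · have h3 := mul_le_mul_of_nonneg_left hY (by linarith : 0 ≤ X)
        have h4 := mul_le_mul_of_nonneg_right hX ht
        have h5 := mul_le_mul_of_nonneg_right hX' hE
        linarith
    rcases lt_or_ge U 1 with hU' | hU'
    · have := thin hs₂ hs₁ hV (by rwa [mul_comm]) (by rwa [min_comm]) hV1 (hU1 hU') hU'
      rw [mul_comm s₂ s₁] at this
      linarith
    rcases lt_or_ge V 1 with hV' | hV'
    · have := thin hs₁ hs₂ hU hW hW' hU1 (hV1 hV') hV'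
      linarith
    -- If `D = V - s₂` is the larger overshoot, then `U * V = U * s₂ + U * D ≥ a * s₁ * s₂ + D`,
    -- since `U ≥ 1`: the layer repays the excess it consumed.
    rcases le_total (U - s₁) (V - s₂) with hd | hd
    · rw [max_eq_right hd] at h2 hpos
      nlinarith [mul_nonneg hpos.le (sub_nonneg.2 hU'), mul_le_mul_of_nonneg_right hU hs₂]
    · rw [max_eq_left hd] at h2 hpos
      nlinarith [mul_nonneg hpos.le (sub_nonneg.2 hV'), mul_le_mul_of_nonneg_left hV hs₁]

/-! ### Induction for pairs of families. -/

namespace IsPadicProximity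

variable {p T : ℕ} {X : Type*} {d : X → X → ℝ} {ι : ℤ → X}

/-- The lower bound for the total proximity of two families of points in a ball of level `j`,
provided that the demands `s₁` and `s₂` are at most `p + ⋯ + p ^ m`. -/
def HasPairBound (p T : ℕ) {X I J : Type*} (d : X → X → ℝ) (ι : ℤ → X) (α : I → X) (β : J → X)
    (m : ℕ) : Prop :=
  ∀ (j : ℕ) (c : ℤ) (A : Finset I) (B : Finset J) (s₁ s₂ E : ℝ), j + m + 1 ≤ T →
    (∀ i ∈ A, (j : ℝ) ≤ d (α i) (ι c)) → (∀ k ∈ B, (j : ℝ) ≤ d (β k) (ι c)) →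
    0 ≤ s₁ → s₁ ≤ p * geomSum p m → 0 ≤ s₂ → s₂ ≤ p * geomSum p m → 0 ≤ E →
    (∀ n : ℤ, (p : ℤ) ^ j ∣ n - c → s₁ ≤ ∑ i ∈ A, (d (α i) (ι n) - j)) →
    (∀ n : ℤ, (p : ℤ) ^ j ∣ n - c → s₂ ≤ ∑ k ∈ B, (d (β k) (ι n) - j)) →
    s₁ + E ≤ ∑ i ∈ A, (d (α i) (ι c) - j) → s₂ + E ≤ ∑ k ∈ B, (d (β k) (ι c) - j) →
    E + (p : ℝ) ^ m / geomSum p m * (s₁ * s₂) ≤ ∑ i ∈ A, ∑ k ∈ B, (d (α i) (β k) - j)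

lemma hasPairBound_zero (h : IsPadicProximity p T d ι) {I J : Type*} (α : I → X) (β : J → X) :
    HasPairBound p T d ι α β 0 := by
  intro j c A B s₁ s₂ E _ hA hB hs₁ hs₁' hs₂ hs₂' hE _ _ hA' hB'
  -- The coefficient is a division by zero, hence `0`; only the excess remains.
  rw [geomSum_zero, div_zero, zero_mul, add_zero]
  calc E ≤ min (∑ i ∈ A, (d (α i) (ι c) - j)) (∑ k ∈ B, (d (β k) (ι c) - j)) :=
        le_min (by linarith) (by linarith)
    _ ≤ _ := min_sum_le_sum_min A B _ _ (fun i hi => sub_nonneg.2 (hA i hi))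
        fun k hk => sub_nonneg.2 (hB k hk)
    _ ≤ _ := Finset.sum_le_sum fun i _ => Finset.sum_le_sum fun k _ => by
        have := h.ultra (α i) (ι c) (β k)
        rw [h.symm (ι c)] at this
        rcases min_le_iff.1 this with h1 | h1
        · exact (min_le_left _ _).trans (by linarith)
        · exact (min_le_right _ _).trans (by linarith)

/-- A point reaching level `j + 1` alone contributes `1` to the layer. A layer total below `1` thus
leaves no deeper points, and the layer must meet everything. -/
lemma add_le_sum_layer (h : IsPadicProximity p T d ι) {I : Type*} (α : I → X)
    (A : Finset I) {j : ℕ} (hT : j + 1 ≤ T) {c : ℤ} (hA : ∀ i ∈ A, (j : ℝ) ≤ d (α i) (ι c))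
    {s : ℝ} (hs : s ≤ ∑ i ∈ A, (d (α i) (ι c) - j))
    (hU : ∑ i ∈ A, layer d ι j c (α i) < 1) : s ≤ ∑ i ∈ A, layer d ι j c (α i) := by
  rw [h.sum_eq_layer_add α A hT (n := c) (by rw [sub_self]; exact dvd_zero _)] at hs
  rwa [Finset.filter_eq_empty_iff.2, Finset.sum_empty, add_zero] at hs
  intro i hi hi'
  have := Finset.single_le_sum (f := fun i => layer d ι j c (α i))
    (fun i hi => layer_nonneg (hA i hi)) hi
  simp only [layer_eq_one hi'] at this
  linarith

lemma class_step (h : IsPadicProximity p T d ι) (hp : 0 < p) {I J : Type*} (α : I → X) (β : J → X)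
    {m : ℕ} (ih : HasPairBound p T d ι α β m) {j : ℕ} {c : ℤ} {A : Finset I} {B : Finset J}
    {s₁ s₂ E : ℝ} (hT : j + m + 2 ≤ T)
    (hA : ∀ i ∈ A, (j : ℝ) ≤ d (α i) (ι c)) (hB : ∀ k ∈ B, (j : ℝ) ≤ d (β k) (ι c))
    (hs₁ : 0 ≤ s₁) (hs₁' : s₁ ≤ p * geomSum p (m + 1))
    (hs₂ : 0 ≤ s₂) (hs₂' : s₂ ≤ p * geomSum p (m + 1)) (hE : 0 ≤ E)
    (hAn : ∀ n : ℤ, (p : ℤ) ^ (j + 1) ∣ n - c → s₁ ≤ ∑ i ∈ A, (d (α i) (ι n) - j))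
    (hBn : ∀ n : ℤ, (p : ℤ) ^ (j + 1) ∣ n - c → s₂ ≤ ∑ k ∈ B, (d (β k) (ι n) - j))
    (hAc : s₁ + E ≤ ∑ i ∈ A, (d (α i) (ι c) - j)) (hBc : s₂ + E ≤ ∑ k ∈ B, (d (β k) (ι c) - j)) :
    E + (p : ℝ) ^ m / geomSum p (m + 1) * (s₁ * s₂)
      ≤ ∑ i ∈ A, ∑ k ∈ B, min (layer d ι j c (α i)) (layer d ι j c (β k))
        + ∑ i ∈ A with ((j + 1 : ℕ) : ℝ) ≤ d (α i) (ι c),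
          ∑ k ∈ B with ((j + 1 : ℕ) : ℝ) ≤ d (β k) (ι c), (d (α i) (β k) - (j + 1 : ℕ)) := by
  have hg := geomSum_succ_pos p m
  have hg0 := geomSum_nonneg p m
  have hpp : (0 : ℝ) < (p : ℝ) ^ m := by positivity
  have hgs := geomSum_succ p m
  have hu : ∀ i ∈ A, 0 ≤ layer d ι j c (α i) := fun i hi => layer_nonneg (hA i hi)
  have hv : ∀ k ∈ B, 0 ≤ layer d ι j c (β k) := fun k hk => layer_nonneg (hB k hk)
  have hUa := h.le_sum_layer hp α A hT hA hs₁' hAn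
  have hVa := h.le_sum_layer hp β B hT hB hs₂' hBn
  -- The remaining demand is at most `s * geomSum p m / geomSum p (m + 1)`, which fits the cap for
  -- `m`.
  have red : ∀ {s U : ℝ}, s ≤ p * geomSum p (m + 1) → (p : ℝ) ^ m * s ≤ geomSum p (m + 1) * U →
      s - U ≤ p * geomSum p m := by
    intro s U hs hU
    refine le_of_mul_le_mul_left ?_ hg
    have h1 := mul_le_mul_of_nonneg_left hs hg0
    rw [hgs] at *
    linarith
  have hA'n : ∀ n : ℤ, (p : ℤ) ^ (j + 1) ∣ n - c →
      max (s₁ - ∑ i ∈ A, layer d ι j c (α i)) 0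
        ≤ ∑ i ∈ A with ((j + 1 : ℕ) : ℝ) ≤ d (α i) (ι c), (d (α i) (ι n) - (j + 1 : ℕ)) := by
    intro n hn
    have := hAn n hn
    rw [h.sum_eq_layer_add α A (by omega) hn] at this
    exact max_le (by linarith) (Finset.sum_nonneg fun i hi => sub_nonneg.2
      (h.ball_shift (by omega) hn (Finset.mem_filter.1 hi).2))
  have hB'n : ∀ n : ℤ, (p : ℤ) ^ (j + 1) ∣ n - c →
      max (s₂ - ∑ k ∈ B, layer d ι j c (β k)) 0
        ≤ ∑ k ∈ B with ((j + 1 : ℕ) : ℝ) ≤ d (β k) (ι c), (d (β k) (ι n) - (j + 1 : ℕ)) := by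
    intro n hn
    have := hBn n hn
    rw [h.sum_eq_layer_add β B (by omega) hn] at this
    exact max_le (by linarith) (Finset.sum_nonneg fun i hi => sub_nonneg.2
      (h.ball_shift (by omega) hn (Finset.mem_filter.1 hi).2))
  have hP : 0 ≤ ∑ i ∈ A with ((j + 1 : ℕ) : ℝ) ≤ d (α i) (ι c),
      ∑ k ∈ B with ((j + 1 : ℕ) : ℝ) ≤ d (β k) (ι c), (d (α i) (β k) - (j + 1 : ℕ)) := by
    refine Finset.sum_nonneg fun i hi => Finset.sum_nonneg fun k hk => sub_nonneg.2 ?_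
    have := h.ultra (α i) (ι c) (β k)
    rw [h.symm (ι c)] at this
    exact (le_min (Finset.mem_filter.1 hi).2 (Finset.mem_filter.1 hk).2).trans this
  have hA'c := hAc
  have hB'c := hBc
  rw [h.sum_eq_layer_add α A (by omega) (n := c) (by rw [sub_self]; exact dvd_zero _)] at hA'c
  rw [h.sum_eq_layer_add β B (by omega) (n := c) (by rw [sub_self]; exact dvd_zero _)] at hB'c
  have hg1 : 0 ≤ p * geomSum p m := by positivity
  apply class_bound hs₁ hs₂ hE (c := (p : ℝ) ^ m / geomSum p m)
    (U := ∑ i ∈ A, layer d ι j c (α i)) (V := ∑ k ∈ B, layer d ι j c (β k))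
  · positivity
  · rw [div_le_one hg]; linarith
  · intro hlt
    rw [div_lt_one hg, hgs] at hlt
    have : geomSum p m ≠ 0 := by intro h0; rw [h0] at hlt; linarith
    field_simp
    rw [hgs]; ring
  · positivity
  · rw [div_mul_eq_mul_div, div_le_iff₀ hg]; linarith
  · rw [div_mul_eq_mul_div, div_le_iff₀ hg]; linarith
  · exact sum_mul_sum_le_sum_min A B _ _ hu hv (fun _ _ => layer_le_one _ _ _)
      fun _ _ => layer_le_one _ _ _
  · exact min_sum_le_sum_min A B _ _ hu hv
  · exact hP
  · exact h.add_le_sum_layer α A (by omega) hA hAc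
  · exact h.add_le_sum_layer β B (by omega) hB hBc
  · intro hU hV
    have := ih (j + 1) c _ _ _ _ E (by omega) (fun i hi => (Finset.mem_filter.1 hi).2)
      (fun k hk => (Finset.mem_filter.1 hk).2) (le_max_right _ _) (max_le (red hs₁' hUa) hg1)
      (le_max_right _ _) (max_le (red hs₂' hVa) hg1) hE hA'n hB'n
      (by rw [max_eq_left (by linarith)]; linarith) (by rw [max_eq_left (by linarith)]; linarith)
    rwa [max_eq_left (sub_nonneg.2 hU), max_eq_left (sub_nonneg.2 hV)] at this
  · intro hpos
    set U := ∑ i ∈ A, layer d ι j c (α i)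
    set V := ∑ k ∈ B, layer d ι j c (β k)
    have hMU := le_max_left (U - s₁) (V - s₂)
    have hMV := le_max_right (U - s₁) (V - s₂)
    -- Subtracting the larger overshoot leaves an excess valid for both families. If it is negative,
    -- nonnegativity of the deeper sum is enough.
    rcases lt_or_ge (E - max (U - s₁) (V - s₂)) 0 with hneg | hE'
    · linarith
    have := ih (j + 1) c _ _ _ _ _ (by omega) (fun i hi => (Finset.mem_filter.1 hi).2)
      (fun k hk => (Finset.mem_filter.1 hk).2) (le_max_right _ _) (max_le (red hs₁' hUa) hg1)
      (le_max_right _ _) (max_le (red hs₂' hVa) hg1) hE' hA'n hB'n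
      (by rw [← le_sub_iff_add_le]; exact max_le (by linarith) (by linarith))
      (by rw [← le_sub_iff_add_le]; exact max_le (by linarith) (by linarith))
    refine le_trans (le_add_of_nonneg_right ?_) this
    have := le_max_right (s₁ - U) 0
    have := le_max_right (s₂ - V) 0
    positivity

/-- The contributions of the `p` subclasses of a ball add up to at most the total proximity. -/
lemma sum_class_le (h : IsPadicProximity p T d ι) (hp : 0 < p) {I J : Type*} (α : I → X)
    (β : J → X) {j : ℕ} (hT : j ≤ T) {c : ℤ} {A : Finset I} {B : Finset J}
    (hA : ∀ i ∈ A, (j : ℝ) ≤ d (α i) (ι c)) (hB : ∀ k ∈ B, (j : ℝ) ≤ d (β k) (ι c)) :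
    ∑ r ∈ Finset.range p, (∑ i ∈ A, ∑ k ∈ B,
        min (layer d ι j (c + r * p ^ j) (α i)) (layer d ι j (c + r * p ^ j) (β k))
      + ∑ i ∈ A with ((j + 1 : ℕ) : ℝ) ≤ d (α i) (ι (c + r * p ^ j)),
        ∑ k ∈ B with ((j + 1 : ℕ) : ℝ) ≤ d (β k) (ι (c + r * p ^ j)),
          (d (α i) (β k) - (j + 1 : ℕ)))
      ≤ ∑ i ∈ A, ∑ k ∈ B, (d (α i) (β k) - j) := by
  simp_rw [Finset.sum_filter, ← Finset.sum_add_distrib]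
  rw [Finset.sum_comm]
  refine Finset.sum_le_sum fun i hi => ?_
  have e : ∀ r : ℕ, (∑ k ∈ B,
        min (layer d ι j (c + r * p ^ j) (α i)) (layer d ι j (c + r * p ^ j) (β k)))
      + (if ((j + 1 : ℕ) : ℝ) ≤ d (α i) (ι (c + r * p ^ j)) then
        ∑ k ∈ B, if ((j + 1 : ℕ) : ℝ) ≤ d (β k) (ι (c + r * p ^ j)) then
          (d (α i) (β k) - (j + 1 : ℕ)) else 0 else 0)
      = ∑ k ∈ B, (min (layer d ι j (c + r * p ^ j) (α i)) (layer d ι j (c + r * p ^ j) (β k))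
        + if ((j + 1 : ℕ) : ℝ) ≤ min (d (α i) (ι (c + r * p ^ j))) (d (β k) (ι (c + r * p ^ j)))
          then (d (α i) (β k) - (j + 1 : ℕ)) else 0) := by
    intro r
    rw [Finset.sum_add_distrib]
    congr 1
    split_ifs with h1
    · refine Finset.sum_congr rfl fun k _ => ?_
      simp only [le_min_iff, h1, true_and]
    · symm
      exact Finset.sum_eq_zero fun k _ => if_neg fun h2 => h1 (h2.trans (min_le_left _ _))
  simp_rw [e]
  rw [Finset.sum_comm]
  refine Finset.sum_le_sum fun k hk => ?_
  have hc : ∀ r : ℕ, (p : ℤ) ^ j ∣ (c + r * p ^ j) - c := fun r => ⟨r, by ring⟩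
  have hi' := fun r => h.ball_shift hT (hc r) (hA i hi)
  have hk' := fun r => h.ball_shift hT (hc r) (hB k hk)
  refine sum_le_of_pairwise_eq_zero ?_ ?_ ?_
  · have := h.ultra (α i) (ι c) (β k)
    rw [h.symm (ι c)] at this
    exact sub_nonneg.2 ((le_min (hA i hi) (hB k hk)).trans this)
  · intro r _
    have h3 := h.ultra (α i) (ι (c + r * p ^ j)) (β k)
    rw [h.symm (ι (c + r * p ^ j))] at h3
    split_ifs with h1
    · rw [layer_eq_one (h1.trans (min_le_left _ _)), layer_eq_one (h1.trans (min_le_right _ _))]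
      push_cast; rw [min_self]; linarith
    · rw [add_zero]
      simp only [layer]
      rcases min_le_iff.1 h3 with h4 | h4
      · refine (min_le_left _ _).trans ?_
        linarith [min_le_left (d (α i) (ι (c + r * p ^ j))) (j + 1 : ℝ)]
      · refine (min_le_right _ _).trans ?_
        linarith [min_le_left (d (β k) (ι (c + r * p ^ j))) (j + 1 : ℝ)]
  -- A class contributes nothing unless `α i` lies beyond level `j` there, which `not_both_lt`
  -- allows for one class only.
  · have zero : ∀ r : ℕ, d (α i) (ι (c + r * p ^ j)) ≤ j →
        min (layer d ι j (c + r * p ^ j) (α i)) (layer d ι j (c + r * p ^ j) (β k))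
        + (if ((j + 1 : ℕ) : ℝ) ≤ min (d (α i) (ι (c + r * p ^ j))) (d (β k) (ι (c + r * p ^ j)))
          then (d (α i) (β k) - (j + 1 : ℕ)) else 0) = 0 := by
      intro r hr
      rw [if_neg, add_zero]
      · have h0 : layer d ι j (c + r * p ^ j) (α i) = 0 := by
          rw [layer, min_eq_left (by linarith)]
          linarith [hi' r]
        rw [h0, min_eq_left (layer_nonneg (hk' r))]
      · intro h1
        have := h1.trans (min_le_left _ _)
        push_cast at this
        linarith
    intro r hr r' hr' hne
    rcases le_or_gt (d (α i) (ι (c + r * p ^ j))) j with h1 | h1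
    · exact Or.inl (zero r h1)
    · exact Or.inr (zero r' (h.not_both_lt hp j c (Finset.mem_range.1 hr)
        (Finset.mem_range.1 hr') hne _ h1))

theorem hasPairBound (h : IsPadicProximity p T d ι) (hp : 0 < p) {I J : Type*} (α : I → X)
    (β : J → X) (m : ℕ) : HasPairBound p T d ι α β m := by
  induction m with
  | zero => exact h.hasPairBound_zero α β
  | succ m ih =>
    intro j c A B s₁ s₂ E hT hA hB hs₁ hs₁' hs₂ hs₂' hE hAn hBn hAc hBc
    refine le_trans ?_ (h.sum_class_le hp α β (by omega) hA hB)
    -- Only `r = 0`, the subclass of `c`, inherits the excess.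
    have key : ∀ r ∈ Finset.range p, (if r = 0 then E else 0)
        + (p : ℝ) ^ m / geomSum p (m + 1) * (s₁ * s₂) ≤ (∑ i ∈ A, ∑ k ∈ B,
        min (layer d ι j (c + r * p ^ j) (α i)) (layer d ι j (c + r * p ^ j) (β k))
      + ∑ i ∈ A with ((j + 1 : ℕ) : ℝ) ≤ d (α i) (ι (c + r * p ^ j)),
        ∑ k ∈ B with ((j + 1 : ℕ) : ℝ) ≤ d (β k) (ι (c + r * p ^ j)),
          (d (α i) (β k) - (j + 1 : ℕ))) := by
      intro r _
      have hc : (p : ℤ) ^ j ∣ (c + r * p ^ j) - c := ⟨r, by ring⟩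
      have hn : ∀ n : ℤ, (p : ℤ) ^ (j + 1) ∣ n - (c + r * p ^ j) → (p : ℤ) ^ j ∣ n - c := by
        intro n hn
        have := dvd_add ((pow_dvd_pow _ (Nat.le_succ j)).trans hn) hc
        rwa [sub_add_sub_cancel] at this
      refine h.class_step hp α β ih (by omega) (fun i hi => h.ball_shift (by omega) hc (hA i hi))
        (fun k hk => h.ball_shift (by omega) hc (hB k hk)) hs₁ hs₁' hs₂ hs₂'
        (by split_ifs <;> simp [hE]) (fun n h' => hAn n (hn n h')) (fun n h' => hBn n (hn n h'))
        ?_ ?_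
      · split_ifs with hr
        · subst hr; simpa using hAc
        · simpa using hAn _ hc
      · split_ifs with hr
        · subst hr; simpa using hBc
        · simpa using hBn _ hc
    refine le_trans (le_of_eq ?_) (Finset.sum_le_sum key)
    rw [Finset.sum_add_distrib, Finset.sum_ite_eq', if_pos (Finset.mem_range.2 hp)]
    simp only [Finset.sum_const, Finset.card_range, nsmul_eq_mul, pow_succ]
    ring

end IsPadicProximity

/-! ### Truncated valuations and roots in the algebraic closure. -/

section PadicAlgCl

variable (p : ℕ) [hp : Fact p.Prime]

lemma PadicAlgCl.norm_intCast (z : ℤ) : ‖(z : PadicAlgCl p)‖ = ‖(z : ℚ_[p])‖ := by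
  rw [← PadicAlgCl.norm_extends, map_intCast]

lemma PadicAlgCl.natCast_le_neg_logb (n : ℕ) (z : ℤ) (hz : z ≠ 0) (h : (p : ℤ) ^ n ∣ z) :
    (n : ℝ) ≤ -Real.logb p ‖(z : PadicAlgCl p)‖ := by
  have hp1 : (1 : ℝ) < p := by exact_mod_cast hp.out.one_lt
  rw [le_neg, Real.logb_le_iff_le_rpow hp1 (by simpa using hz), PadicAlgCl.norm_intCast]
  have := (Padic.norm_int_le_pow_iff_dvd z n).2 (by exact_mod_cast h)
  rw [← Real.rpow_intCast] at this
  simpa using this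

lemma PadicAlgCl.neg_logb_le_natCast (n : ℕ) (z : ℤ) (h : ¬ (p : ℤ) ^ (n + 1) ∣ z) :
    -Real.logb p ‖(z : PadicAlgCl p)‖ ≤ n := by
  have hp1 : (1 : ℝ) < p := by exact_mod_cast hp.out.one_lt
  have hz : z ≠ 0 := by rintro rfl; exact h (dvd_zero _)
  rw [neg_le, Real.le_logb_iff_rpow_le hp1 (by simpa using hz), PadicAlgCl.norm_intCast]
  have h1 := mt (Padic.norm_int_le_pow_iff_dvd (p := p) z (n + 1)).1 (by exact_mod_cast h)
  rw [Padic.norm_le_pow_iff_norm_lt_pow_add_one, not_lt] at h1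
  rw [← Real.rpow_intCast] at h1
  simpa using h1

lemma PadicAlgCl.norm_le_one_of_isIntegral {x : PadicAlgCl p} (hx : IsIntegral ℤ x) :
    ‖x‖ ≤ 1 := by
  have h := (Valuation.integer.integers (PadicAlgCl.valued p).v).mem_of_integral hx.tower_top
  rw [← PadicAlgCl.valuation_coe]
  exact_mod_cast h

open Classical in
/-- The valuation of `x - y`, truncated at the height `T`. -/
noncomputable def PadicAlgCl.proximity (T : ℕ) (x y : PadicAlgCl p) : ℝ :=
  if x = y then T else min (T : ℝ) (-Real.logb p ‖x - y‖)

namespace PadicAlgCl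

lemma proximity_le (T : ℕ) (x y : PadicAlgCl p) : proximity p T x y ≤ T := by
  unfold proximity
  split_ifs
  · exact le_rfl
  · exact min_le_left _ _

lemma isPadicProximity (T : ℕ) :
    IsPadicProximity p T (proximity p T) (fun n : ℤ => (n : PadicAlgCl p)) where
  symm x y := by
    classical
    rw [proximity, proximity, norm_sub_rev]
    exact if_congr eq_comm rfl rfl
  ultra x y z := by
    by_cases hxz : x = z
    · rw [proximity.eq_1 p T x z, if_pos hxz]
      exact (min_le_left _ _).trans (proximity_le p T x y)
    by_cases hxy : x = y
    · subst hxy; exact min_le_right _ _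
    by_cases hyz : y = z
    · subst hyz; exact min_le_left _ _
    simp only [proximity, hxz, hxy, hyz, if_false]
    have hp1 : (1 : ℝ) < p := by exact_mod_cast hp.out.one_lt
    have h1 : ‖x - z‖ ≤ max ‖x - y‖ ‖y - z‖ := by
      simpa [dist_eq_norm] using dist_triangle_max x y z
    have h0 : 0 < ‖x - z‖ := norm_pos_iff.2 (sub_ne_zero.2 hxz)
    refine le_min ((min_le_left _ _).trans (min_le_left _ _)) ?_
    rcases le_max_iff.1 h1 with h | h
    · exact (min_le_left _ _).trans ((min_le_right _ _).trans
        (neg_le_neg (Real.logb_le_logb_of_le hp1 h0 h)))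
    · exact (min_le_right _ _).trans ((min_le_right _ _).trans
        (neg_le_neg (Real.logb_le_logb_of_le hp1 h0 h)))
  le_of_dvd i a b hi h := by
    unfold proximity
    split_ifs with hab
    · exact_mod_cast hi
    · refine le_min (by exact_mod_cast hi) ?_
      rw [← Int.cast_sub]
      refine natCast_le_neg_logb p i _ ?_ h
      rintro h0
      exact hab (by rw [sub_eq_zero.1 h0])
  le_of_not_dvd i a b h := by
    rw [proximity, if_neg]
    · refine (min_le_right _ _).trans ?_
      rw [← Int.cast_sub]
      exact neg_logb_le_natCast p i _ h
    · intro hab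
      rw [Int.cast_inj] at hab
      simp [hab] at h

lemma proximity_nonneg (T : ℕ) {x y : PadicAlgCl p} (hx : ‖x‖ ≤ 1) (hy : ‖y‖ ≤ 1) :
    0 ≤ proximity p T x y := by
  unfold proximity
  split_ifs with h
  · positivity
  · refine le_min (by positivity) (neg_nonneg.2 ?_)
    have hp1 : (1 : ℝ) < p := by exact_mod_cast hp.out.one_lt
    refine (Real.logb_nonpos_iff hp1 (norm_pos_iff.2 (sub_ne_zero.2 h))).2 ?_
    rw [sub_eq_add_neg]
    exact (isNonarchimedean p x (-y)).trans (max_le hx (by rwa [norm_neg]))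

lemma neg_logb_norm_prod {ι : Type*} (s : Finset ι) (x : ι → PadicAlgCl p)
    (h : ∀ i ∈ s, x i ≠ 0) :
    -Real.logb p ‖∏ i ∈ s, x i‖ = ∑ i ∈ s, -Real.logb p ‖x i‖ := by
  rw [norm_prod, Real.logb_prod _ _ fun i hi => norm_ne_zero_iff.2 (h i hi), Finset.sum_neg_distrib]

/-- If `p ^ s` divides the product of the `n - α i`, the total proximity of `n` to the `α i` is at
least `s`. -/
lemma le_sum_proximity {T s : ℕ} (hs : s ≤ T) {ι : Type*} [Fintype ι] (α : ι → PadicAlgCl p)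
    (hα : ∀ i, ‖α i‖ ≤ 1) {n z : ℤ} (hz : (z : PadicAlgCl p) = ∏ i, ((n : PadicAlgCl p) - α i))
    (hd : (p : ℤ) ^ s ∣ z) : (s : ℝ) ≤ ∑ i, proximity p T (α i) n := by
  have hn : ‖(n : PadicAlgCl p)‖ ≤ 1 := by rw [norm_intCast]; exact Padic.norm_int_le_one n
  -- One root at height `T` meets the demand alone; otherwise nothing is truncated.
  by_cases h : ∃ i, proximity p T (α i) n = T
  · obtain ⟨i, hi⟩ := h
    calc (s : ℝ) ≤ T := by exact_mod_cast hs
      _ = proximity p T (α i) n := hi.symm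
      _ ≤ _ := Finset.single_le_sum (f := fun i => proximity p T (α i) n)
        (fun i _ => proximity_nonneg p T (hα i) hn) (Finset.mem_univ i)
  · push Not at h
    have hne : ∀ i, (n : PadicAlgCl p) - α i ≠ 0 := by
      intro i h0
      exact h i (by rw [proximity, if_pos (sub_eq_zero.1 h0).symm])
    have hz0 : z ≠ 0 := by
      rintro rfl
      rw [Int.cast_zero] at hz
      exact Finset.prod_ne_zero_iff.2 (fun i _ => hne i) hz.symm
    have := natCast_le_neg_logb p s z hz0 hd
    rw [hz, neg_logb_norm_prod p _ _ fun i _ => hne i] at this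
    refine this.trans (Finset.sum_le_sum fun i _ => ?_)
    have h1 := h i
    rw [proximity, if_neg fun h0 => hne i (by rw [h0, sub_self])] at h1 ⊢
    rw [norm_sub_rev]
    rcases min_choice (T : ℝ) (-Real.logb p ‖α i - n‖) with h2 | h2
    · exact absurd h2 h1
    · exact h2.ge

/-- A monic integer polynomial is a product of linear factors with roots of norm at most `1`. -/
lemma exists_roots {f : ℤ[X]} (hf : f.Monic) :
    ∃ (N : ℕ) (α : Fin N → PadicAlgCl p), (∀ i, ‖α i‖ ≤ 1) ∧
      (f.map (Int.castRingHom (PadicAlgCl p))).roots = Finset.univ.val.map α ∧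
      ∀ n : ℤ, ((f.eval n : ℤ) : PadicAlgCl p) = ∏ i, ((n : PadicAlgCl p) - α i) := by
  set F := f.map (Int.castRingHom (PadicAlgCl p)) with hF
  obtain ⟨l, hl⟩ := Quotient.exists_rep F.roots
  have hroots : F.roots = Finset.univ.val.map l.get := by
    rw [← hl, Fin.univ_val_map, List.ofFn_get]; rfl
  refine ⟨l.length, l.get, fun i => ?_, hroots, fun n => ?_⟩
  · apply norm_le_one_of_isIntegral
    refine ⟨f, hf, ?_⟩
    have : l.get i ∈ F.roots := by rw [hroots]; simp
    have := isRoot_of_mem_roots this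
    rwa [IsRoot, hF, eval_map] at this
  · have h1 := (IsAlgClosed.splits F).eq_prod_roots_of_monic (hf.map _)
    have h2 : F.eval (n : PadicAlgCl p) = ((f.eval n : ℤ) : PadicAlgCl p) := by
      rw [hF, eval_intCast_map]; rfl
    rw [← h2, h1, hroots, Multiset.map_map, eval_multiset_prod, Multiset.map_map]
    simp

end PadicAlgCl

end PadicAlgCl

/-! ### The resultant and the choice of `m`. -/

/-- The bound with `E` in place of `S - max s₁ s₂`, for a nonzero resultant. -/
lemma le_of_not_pow_dvd_resultant {p : ℕ} (hp : p.Prime) {f g : ℤ[X]} (hf : f.Monic)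
    (hg : g.Monic) {s₁ s₂ S m : ℕ} {E : ℝ} {c : ℤ} (hE : 0 ≤ E)
    (hs₁ : ∀ n : ℤ, (p : ℤ) ^ s₁ ∣ f.eval n) (hs₂ : ∀ n : ℤ, (p : ℤ) ^ s₂ ∣ g.eval n)
    (hfS : (p : ℤ) ^ S ∣ f.eval c) (hgS : (p : ℤ) ^ S ∣ g.eval c)
    (hm₁ : (s₁ : ℝ) ≤ p * geomSum p m) (hm₂ : (s₂ : ℝ) ≤ p * geomSum p m)
    (hE₁ : s₁ + E ≤ max (s₁ : ℝ) S) (hE₂ : s₂ + E ≤ max (s₂ : ℝ) S)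
    {N : ℕ} (hN : ¬ (p : ℤ) ^ (N + 1) ∣ f.resultant g) :
    E + (p : ℝ) ^ m / geomSum p m * (s₁ * s₂) ≤ N := by
  have : Fact p.Prime := ⟨hp⟩
  obtain ⟨a, α, hα, hαr, hαf⟩ := PadicAlgCl.exists_roots p hf
  obtain ⟨b, β, hβ, hβr, hβg⟩ := PadicAlgCl.exists_roots p hg
  -- High enough for the `m + 1` levels of the induction and for truncation to preserve the bounds
  -- `s₁`, `s₂`, `S`.
  set T := s₁ + s₂ + S + m + 1 with hT
  have hn : ∀ n : ℤ, ‖(n : PadicAlgCl p)‖ ≤ 1 := fun n => by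
    rw [PadicAlgCl.norm_intCast]; exact Padic.norm_int_le_one n
  have hA : ∀ n : ℤ, (s₁ : ℝ) ≤ ∑ i, PadicAlgCl.proximity p T (α i) n := fun n =>
    PadicAlgCl.le_sum_proximity p (by omega) α hα (hαf n) (hs₁ n)
  have hB : ∀ n : ℤ, (s₂ : ℝ) ≤ ∑ i, PadicAlgCl.proximity p T (β i) n := fun n =>
    PadicAlgCl.le_sum_proximity p (by omega) β hβ (hβg n) (hs₂ n)
  have hAS := PadicAlgCl.le_sum_proximity p (T := T) (by omega) α hα (hαf c) hfS
  have hBS := PadicAlgCl.le_sum_proximity p (T := T) (by omega) β hβ (hβg c) hgS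
  have key := (PadicAlgCl.isPadicProximity p T).hasPairBound hp.pos α β m 0 c Finset.univ
    Finset.univ s₁ s₂ E (by omega)
    (fun i _ => by simpa using PadicAlgCl.proximity_nonneg p T (hα i) (hn c))
    (fun i _ => by simpa using PadicAlgCl.proximity_nonneg p T (hβ i) (hn c))
    (by positivity) hm₁ (by positivity) hm₂ hE (fun n _ => by simpa using hA n)
    (fun n _ => by simpa using hB n)
    (by simpa using hE₁.trans (max_le (hA c) hAS)) (by simpa using hE₂.trans (max_le (hB c) hBS))
  refine key.trans (le_trans ?_ (PadicAlgCl.neg_logb_le_natCast p N _ hN))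
  have hres : ((f.resultant g : ℤ) : PadicAlgCl p) = ∏ x : Fin a × Fin b, (α x.1 - β x.2) := by
    have h1 := resultant_map_map f g f.natDegree g.natDegree (Int.castRingHom (PadicAlgCl p))
    rw [eq_intCast] at h1
    rw [← h1]
    have h2 := resultant_eq_prod_roots_sub (f.map (Int.castRingHom (PadicAlgCl p)))
      (g.map (Int.castRingHom (PadicAlgCl p))) (hf.map _) (hg.map _) (IsAlgClosed.splits _)
      (IsAlgClosed.splits _)
    rw [hf.natDegree_map, hg.natDegree_map] at h2
    rw [h2, hαr, hβr, Fintype.prod_prod_type]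
    simp only [SProd.sprod, Multiset.product, Multiset.map_bind, Multiset.prod_bind,
      Multiset.map_map, Finset.prod, Function.comp_def]
  have hne : ∀ x : Fin a × Fin b, α x.1 - β x.2 ≠ 0 := by
    intro x h0
    rw [Finset.prod_eq_zero (Finset.mem_univ x) h0, Int.cast_eq_zero] at hres
    exact hN (hres ▸ dvd_zero _)
  rw [hres, PadicAlgCl.neg_logb_norm_prod p _ _ fun x _ => hne x, ← Finset.sum_product']
  refine Finset.sum_le_sum fun x _ => ?_
  rw [PadicAlgCl.proximity, if_neg (sub_ne_zero.1 (hne x)), Nat.cast_zero, sub_zero]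
  exact min_le_right _ _

lemma mul_geomSum (p m : ℕ) : ((p : ℝ) - 1) * geomSum p m = (p : ℝ) ^ m - 1 :=
  mul_geom_sum _ _

/-- By the choice of the logarithm `m`, `t < geomSum p (m + 1) = p * geomSum p m + 1`; integrality
removes the `1`. -/
lemma le_mul_geomSum_log {p : ℕ} (hp : p.Prime) {s t : ℕ} (hst : s ≤ t) :
    (s : ℝ) ≤ p * geomSum p (Nat.log p ((p - 1) * t + 1)) := by
  set m := Nat.log p ((p - 1) * t + 1) with hm
  have h1 : (p - 1) * t + 1 < p ^ (m + 1) := Nat.lt_pow_succ_log_self hp.one_lt _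
  have h2 : ((p : ℝ) - 1) * t + 1 < p ^ (m + 1) := by
    have : (((p - 1) * t + 1 : ℕ) : ℝ) < ((p ^ (m + 1) : ℕ) : ℝ) := by exact_mod_cast h1
    rw [Nat.cast_add, Nat.cast_mul, Nat.cast_sub hp.one_le] at this
    simpa using this
  have hp1 : (1 : ℝ) < p := by exact_mod_cast hp.one_lt
  have h3 : (t : ℝ) < geomSum p (m + 1) := by
    have := mul_geomSum p (m + 1)
    refine lt_of_mul_lt_mul_left (a := (p : ℝ) - 1) ?_ (by linarith)
    linarith
  rw [geomSum_succ'] at h3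
  have h4 : t ≤ p * ∑ i ∈ Finset.range m, p ^ i := by
    refine Nat.lt_succ_iff.1 ?_
    unfold geomSum at h3
    exact_mod_cast h3
  unfold geomSum
  exact_mod_cast hst.trans h4

/-- The `p`-adic valuation of an integer is `emultiplicity (p : ℤ) _`, with values in `ℕ∞`
(so `0` has valuation `⊤`). As the lower bound is a real number which may be negative, it is
compared with the valuation of the resultant in the extended reals. If `s₁ = s₂ = 0`, then
`p - p ^ (-k) = 0` and the last term of the bound is `0`. -/
theorem mainTheorem3 (p : ℕ) (hp : p.Prime) (f g : ℤ[X]) (hf : f.Monic) (hg : g.Monic)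
    (s₁ s₂ S : ℕ)
    (hs₁ : ∀ n : ℤ, (s₁ : ℕ∞) ≤ emultiplicity (p : ℤ) (f.eval n))
    (hs₂ : ∀ n : ℤ, (s₂ : ℕ∞) ≤ emultiplicity (p : ℤ) (g.eval n))
    (hS : IsGreatest (Set.range fun n : ℤ =>
      min (emultiplicity (p : ℤ) (f.eval n)) (emultiplicity (p : ℤ) (g.eval n))) (S : ℕ∞))
    (k : ℤ) (hk : k = ⌊Real.logb (p : ℝ) (((p : ℝ) - 1) * max (s₁ : ℝ) (s₂ : ℝ) + 1)⌋ - 1) :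
    (((S : ℝ) - max (s₁ : ℝ) (s₂ : ℝ)
        + (p : ℝ) * s₁ * s₂ * (((p : ℝ) - 1) / ((p : ℝ) - (p : ℝ) ^ (-k))) : ℝ) : EReal)
      ≤ (((emultiplicity (p : ℤ) (f.resultant g) : ℕ∞) : ℝ≥0∞) : EReal) := by
  obtain ⟨c, hc⟩ := hS.1
  have hc' : (S : ℕ∞) ≤ min (emultiplicity (p : ℤ) (f.eval c)) (emultiplicity (p : ℤ) (g.eval c)) :=
    hc.ge
  rw [le_min_iff] at hc'
  by_cases hfin : FiniteMultiplicity (p : ℤ) (f.resultant g)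
  swap
  · rw [emultiplicity_eq_top.2 hfin]; simp
  rw [hfin.emultiplicity_eq_multiplicity]
  set N := multiplicity (p : ℤ) (f.resultant g)
  have hN : ¬ (p : ℤ) ^ (N + 1) ∣ f.resultant g := hfin.not_pow_dvd_of_multiplicity_lt (by omega)
  set m := Nat.log p ((p - 1) * max s₁ s₂ + 1) with hm
  have hp1 : (1 : ℝ) < p := by exact_mod_cast hp.one_lt
  have hkm : k = m - 1 := by
    have e : ((p : ℝ) - 1) * max (s₁ : ℝ) (s₂ : ℝ) + 1
        = (((p - 1) * max s₁ s₂ + 1 : ℕ) : ℝ) := by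
      rw [Nat.cast_add, Nat.cast_mul, Nat.cast_sub hp.one_le]; simp
    rw [hk, e, Real.floor_logb_natCast (by positivity), Int.log_natCast]
  -- Since `k = m - 1`, the denominator is `p * (p - 1) * geomSum p m / p ^ m`. For `m = 0` both
  -- sides are `0` by division by zero.
  have hcoef : (p : ℝ) * s₁ * s₂ * (((p : ℝ) - 1) / ((p : ℝ) - (p : ℝ) ^ (-k)))
      = (p : ℝ) ^ m / geomSum p m * (s₁ * s₂) := by
    have hg := mul_geomSum p m
    have e : (p : ℝ) ^ (-k) = p / p ^ m := by
      rw [hkm, neg_sub, zpow_sub₀ (by positivity), zpow_one, zpow_natCast]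
    rw [e, show (p : ℝ) - p / p ^ m = p * (((p : ℝ) - 1) * geomSum p m) / p ^ m by
      rw [hg]; field_simp]
    have : (p : ℝ) - 1 ≠ 0 := by linarith
    field_simp
  have main := le_of_not_pow_dvd_resultant hp hf hg (E := max 0 ((S : ℝ) - max (s₁ : ℝ) s₂))
    (le_max_left _ _) (fun n => pow_dvd_of_le_emultiplicity (hs₁ n))
    (fun n => pow_dvd_of_le_emultiplicity (hs₂ n)) (pow_dvd_of_le_emultiplicity hc'.1)
    (pow_dvd_of_le_emultiplicity hc'.2) (m := m) (le_mul_geomSum_log hp (le_max_left _ _))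
    (le_mul_geomSum_log hp (le_max_right _ _))
    (by
      rw [← max_add_add_left, add_zero]
      exact max_le_max le_rfl (by linarith [le_max_left (s₁ : ℝ) s₂]))
    (by
      rw [← max_add_add_left, add_zero]
      exact max_le_max le_rfl (by linarith [le_max_right (s₁ : ℝ) s₂])) hN
  have hreal : (S : ℝ) - max (s₁ : ℝ) (s₂ : ℝ)
      + (p : ℝ) * s₁ * s₂ * (((p : ℝ) - 1) / ((p : ℝ) - (p : ℝ) ^ (-k))) ≤ N := by
    rw [hcoef]
    linarith [le_max_right 0 ((S : ℝ) - max (s₁ : ℝ) s₂)]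
  calc _ ≤ ((N : ℝ) : EReal) := EReal.coe_le_coe_iff.2 hreal
    _ = _ := by simp only [ENat.toENNReal_coe]; rfl
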